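/- Let $n\ge 1$, $[n]=\{1,\dots,n\}$, and let $f:2^{[n]}\to\mathbb Z$ satisfy $f(\emptyset)=0$ and $f(I)+f(J)\ge f(I\cup J)+f(I\cap J)$ for all $I,J\subseteq[n]$. Let $$P=\Big\{\mathbf a\in\mathbb Z^n : \sum_{i\in I}a_i\le f(I)\text{ for all } I\subseteq[n],\ \sum_{i\in[n]}a_i=f([n])\Big\}$$ be the polymatroid over $[n]$ with rank function $f$. Let $\mathbf e_1,\dots,\mathbf e_n$ be the standard basis of $\mathbb Z^n$. For $\mathbf a\in P$, let $\mathrm{Int}(\mathbf a)$ be the set of all $i\in[n]$ such that $\mathbf a-\mathbf e_i+\mathbf e_j\notin P$ for every $j<i$, let $\mathrm{Ext}(\mathbf a)$ be the set of all $i\in[n]$ such that $\mathbf a+\mathbf e_i-\mathbf e_j\notin P$ for every $j<i$, and put $$\mathscr T_P(x,y)=\sum_{\mathbf a\in P}x^{|\mathrm{Int}(\mathbf a)\setminus\mathrm{Ext}(\mathbf a)|}\,y^{|\mathrm{Ext}(\mathbf a)\setminus\mathrm{Int}(\mathbf a)|}\,(x+y-1)^{|\mathrm{Int}(\mathbf a)\cap\mathrm{Ext}(\mathbf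 a)|}.$$ Then: 1. the coefficient of $x^{n-2}$ in $\mathscr T_P(x,1)$ is $$\binom{\sum_{i\in[n]}f(\{i\})-f([n])+1}{2}-\sum_{\{i,j\}\subseteq[n],\,i\ne j}\binom{f(\{i\})+f(\{j\})-f(\{i,j\})+1}{2};$$ 2. the coefficient of $y^{n-2}$ in $\mathscr T_P(1,y)$ is $$\binom{\sum_{i\in[n]}f([n]\setminus\{i\})-(n-1)f([n])+1}{2}-\sum_{\{i,j\}\subseteq[n],\,i\ne j}\binom{f([n]\setminus\{i\})+f([n]\setminus\{j\})-f([n]\setminus\{i,j\})-f([n])+1}{2}.$$ Here the sums run over the unordered pairs of distinct elements of $[n]$, and the coefficient of a negative power of the variable (the case $n=1$) is $0$. -/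

import Mathlib

/-- `P ⊆ ℤⁿ` is the (integer) polymatroid over the ground set `Fin n` with rank function `f`:
`f` is integer valued, submodular, vanishes at `∅`, and `P` is the set of its integer bases. -/
structure IsPolymatroid {n : ℕ} (P : Set (Fin n → ℤ)) (f : Finset (Fin n) → ℤ) : Prop where
  rank_empty : f ∅ = 0
  submodular : ∀ I J : Finset (Fin n), f (I ∪ J) + f (I ∩ J) ≤ f I + f J
  eq_bases : P = {a | (∀ I : Finset (Fin n), ∑ i ∈ I, a i ≤ f I) ∧ ∑ i, a i = f Finset.univ}

/-- A polymatroid is a finite set, so that the sum defining its Tutte polynomial is finite. -/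
theorem IsPolymatroid.finite {n : ℕ} {P : Set (Fin n → ℤ)} {f : Finset (Fin n) → ℤ}
    (h : IsPolymatroid P f) : P.Finite := by
  refine (Set.finite_Icc (fun i : Fin n => f Finset.univ - f {i}ᶜ)
    (fun i : Fin n => f {i})).subset ?_
  intro a ha
  rw [h.eq_bases] at ha
  obtain ⟨h1, h2⟩ := ha
  refine ⟨fun i => ?_, fun i => by simpa using h1 {i}⟩
  have h3 := h1 {i}ᶜ
  have h4 := Finset.sum_add_sum_compl {i} a
  simp only [Finset.sum_singleton] at h4
  show f Finset.univ - f {i}ᶜ ≤ a i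
  linarith

/-- `i` is internally active for the basis `a` of `P`: `a - eᵢ + eⱼ ∉ P` for all `j < i`. -/
def InternallyActive {n : ℕ} (P : Set (Fin n → ℤ)) (a : Fin n → ℤ) (i : Fin n) : Prop :=
  ∀ j < i, a - Pi.single i 1 + Pi.single j 1 ∉ P

/-- `i` is externally active for the basis `a` of `P`: `a + eᵢ - eⱼ ∉ P` for all `j < i`. -/
def ExternallyActive {n : ℕ} (P : Set (Fin n → ℤ)) (a : Fin n → ℤ) (i : Fin n) : Prop :=
  ∀ j < i, a + Pi.single i 1 - Pi.single j 1 ∉ P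

open Classical in
/-- The set `Int(a)` of internally active indices. -/
noncomputable def intActive {n : ℕ} (P : Set (Fin n → ℤ)) (a : Fin n → ℤ) : Finset (Fin n) :=
  Finset.univ.filter (InternallyActive P a)

open Classical in
/-- The set `Ext(a)` of externally active indices. -/
noncomputable def extActive {n : ℕ} (P : Set (Fin n → ℤ)) (a : Fin n → ℤ) : Finset (Fin n) :=
  Finset.univ.filter (ExternallyActive P a)

/-- The polymatroid Tutte polynomial of `P`, a polynomial over `ℤ` in the two variables
`x = X 0` and `y = X 1`: the sum over `a ∈ P` of `x ^ oi(a) * y ^ oe(a) * (x + y - 1) ^ ie(a)`. -/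
noncomputable def polymatroidTutte {n : ℕ} (P : Set (Fin n → ℤ)) : MvPolynomial (Fin 2) ℤ :=
  ∑ᶠ a ∈ P,
    MvPolynomial.X 0 ^ (intActive P a \ extActive P a).card *
    MvPolynomial.X 1 ^ (extActive P a \ intActive P a).card *
    (MvPolynomial.X 0 + MvPolynomial.X 1 - 1) ^ (intActive P a ∩ extActive P a).card

/-- The specialization `T(x, 1)`, a polynomial in `x`. -/
noncomputable def specializeX (T : MvPolynomial (Fin 2) ℤ) : Polynomial ℤ :=
  MvPolynomial.aeval ![Polynomial.X, 1] T

/-- The specialization `T(1, y)`, a polynomial in `y`. -/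
noncomputable def specializeY (T : MvPolynomial (Fin 2) ℤ) : Polynomial ℤ :=
  MvPolynomial.aeval ![1, Polynomial.X] T

/-- The coefficient of the `k`-th power of the variable for an integer exponent `k`
(a polynomial has coefficient `0` at negative exponents). -/
noncomputable def coeffAt (p : Polynomial ℤ) (k : ℤ) : ℤ :=
  if 0 ≤ k then p.coeff k.toNat else 0

/-! ### Bases, exchange, and the orthant decomposition -/

namespace IsPolymatroid

variable {n : ℕ} {P : Set (Fin n → ℤ)} {f : Finset (Fin n) → ℤ}

/-! At `y = 1` the Tutte polynomial is `∑ x ^ |Int(a)|`, so the coefficient counts the bases whose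
inactive set `B = Int(a)ᶜ` has two elements. The integer vectors below `f` are partitioned by the
orthants `a - ℕ^{Int(a)}` (`existsUnique_orthant`).

Slice this partition by fixing the coordinates off a set `S`, `|S| ≤ 2`, at a very negative `-M`.
The orthant of `a` meets the slice iff `B ⊆ S`; above level `-M` on `S` it then contributes a factor
`1` for each `i ∈ S ∩ B` and `y i = a i + M` for each `i ∈ S \ B`. Counting the slice directly gives
an interval, or a box minus a triangle whose size is the binomial of the pair. Since `∑ y i` is
constant on `P`, a fixed combination of these counts isolates `|B| = 2`
(`Finset.indicator_card_two`). The second formula is the first for `-P`. -/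

theorem mem_iff (h : IsPolymatroid P f) {a : Fin n → ℤ} :
    a ∈ P ↔ (∀ I : Finset (Fin n), ∑ i ∈ I, a i ≤ f I) ∧ ∑ i, a i = f Finset.univ := by
  rw [h.eq_bases]; rfl

/-- Tight sets of a vector below the rank function are closed under unions and intersections. -/
theorem tight_union_inter (h : IsPolymatroid P f) {d : Fin n → ℤ}
    (hd : ∀ I : Finset (Fin n), ∑ i ∈ I, d i ≤ f I) {I J : Finset (Fin n)}
    (hI : ∑ i ∈ I, d i = f I) (hJ : ∑ i ∈ J, d i = f J) :
    ∑ i ∈ I ∪ J, d i = f (I ∪ J) ∧ ∑ i ∈ I ∩ J, d i = f (I ∩ J) := by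
  have h1 := h.submodular I J
  have h2 := Finset.sum_union_inter (s₁ := I) (s₂ := J) (f := d)
  have h3 := hd (I ∪ J)
  have h4 := hd (I ∩ J)
  constructor <;> linarith

/-- Every vector below the rank function is dominated by a basis. -/
theorem exists_basis_ge (h : IsPolymatroid P f) {c : Fin n → ℤ}
    (hc : ∀ I : Finset (Fin n), ∑ i ∈ I, c i ≤ f I) : ∃ a ∈ P, c ≤ a := by
  have hfin : {d : Fin n → ℤ | (∀ I : Finset (Fin n), ∑ i ∈ I, d i ≤ f I) ∧ c ≤ d}.Finite := by
    refine (Set.finite_Icc c (fun i : Fin n => f {i})).subset ?_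
    rintro d ⟨h1, h2⟩
    exact ⟨h2, fun i => by simpa using h1 {i}⟩
  obtain ⟨d, ⟨hd, hcd⟩, hmax⟩ := Set.exists_max_image _ (fun d : Fin n → ℤ => ∑ i, d i) hfin
    ⟨c, hc, le_rfl⟩
  -- Maximality of the coordinate sum puts every index in a tight set; their union, the whole ground
  -- set, is then tight.
  have htight : ∀ i, ∃ I : Finset (Fin n), i ∈ I ∧ ∑ k ∈ I, d k = f I := by
    intro i
    by_contra! hno
    have hmem : d + Pi.single i 1 ∈
        {d : Fin n → ℤ | (∀ I : Finset (Fin n), ∑ i ∈ I, d i ≤ f I) ∧ c ≤ d} := by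
      constructor
      · intro I
        have h1 := hd I
        have h2 := hno I
        simp only [Pi.add_apply, Finset.sum_add_distrib, Pi.single_apply,
          Finset.sum_ite_eq']
        split_ifs with hi
        · have := h2 hi
          omega
        · omega
      · intro k
        have : c k ≤ d k := hcd k
        have h0 : (0 : ℤ) ≤ Pi.single (M := fun _ : Fin n => ℤ) i 1 k := by
          by_cases hk : k = i
          · subst hk; simp
          · simp [hk]
        exact le_add_of_le_of_nonneg this h0
    have := hmax _ hmem
    simp [Finset.sum_add_distrib] at this
  have hcover : ∀ S : Finset (Fin n), ∃ T, S ⊆ T ∧ ∑ k ∈ T, d k = f T := by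
    intro S
    induction S using Finset.induction_on with
    | empty => exact ⟨∅, le_rfl, by simp [h.rank_empty]⟩
    | insert i S _ ih =>
      obtain ⟨T, hST, hT⟩ := ih
      obtain ⟨I, hi, hI⟩ := htight i
      refine ⟨I ∪ T, ?_, (h.tight_union_inter hd hI hT).1⟩
      intro k hk
      rcases Finset.mem_insert.1 hk with rfl | hk
      · exact Finset.mem_union_left _ hi
      · exact Finset.mem_union_right _ (hST hk)
  obtain ⟨T, hT, hT'⟩ := hcover Finset.univ
  rw [Finset.univ_subset_iff] at hT
  subst hT
  exact ⟨d, h.mem_iff.2 ⟨hd, hT'⟩, hcd⟩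

/-- The basis exchange property. -/
theorem exchange (h : IsPolymatroid P f) {a b : Fin n → ℤ} (ha : a ∈ P) (hb : b ∈ P)
    {j : Fin n} (hj : a j < b j) :
    ∃ i, b i < a i ∧ a - Pi.single i 1 + Pi.single j 1 ∈ P := by
  classical
  rw [h.mem_iff] at ha hb
  -- `T` is the least tight set containing `j`. For `i ∈ T`, every tight set containing `j` contains
  -- `i`, so the exchange violates no constraint.
  obtain ⟨T, hT, hmin⟩ := Finset.exists_min_image
    (Finset.univ.filter fun T : Finset (Fin n) => j ∈ T ∧ ∑ k ∈ T, a k = f T) Finset.card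
    ⟨Finset.univ, by simp [ha.2]⟩
  simp only [Finset.mem_filter, Finset.mem_univ, true_and] at hT hmin
  have hsub : ∀ I : Finset (Fin n), j ∈ I → ∑ k ∈ I, a k = f I → T ⊆ I := by
    intro I hjI hI
    have h1 := hmin (T ∩ I) ⟨Finset.mem_inter.2 ⟨hT.1, hjI⟩, (h.tight_union_inter ha.1 hT.2 hI).2⟩
    exact Finset.inter_eq_left.1 (Finset.eq_of_subset_of_card_le Finset.inter_subset_left h1)
  obtain ⟨i, hiT, hi⟩ : ∃ i ∈ T, b i < a i := by
    by_contra! hno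
    have h1 := Finset.sum_lt_sum hno ⟨j, hT.1, hj⟩
    have h2 := hb.1 T
    linarith [hT.2]
  refine ⟨i, hi, h.mem_iff.2 ⟨fun I => ?_, ?_⟩⟩
  · have h1 := ha.1 I
    have h2 := hsub I
    simp only [Pi.add_apply, Pi.sub_apply, Finset.sum_add_distrib, Finset.sum_sub_distrib,
      Pi.single_apply, Finset.sum_ite_eq']
    by_cases hjI : j ∈ I
    · by_cases hiI : i ∈ I
      · simp only [hiI, hjI, if_true]; omega
      · have : ∑ k ∈ I, a k ≠ f I := fun he => hiI (h2 hjI he hiT)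
        simp only [hiI, hjI, if_true, if_false]; omega
    · simp only [hjI, if_false]
      split_ifs <;> omega
  · simp [Finset.sum_add_distrib, Finset.sum_sub_distrib, ha.2]

theorem mem_intActive {a : Fin n → ℤ} {i : Fin n} :
    i ∈ intActive P a ↔ InternallyActive P a i := by
  simp [intActive]

/-- The vectors below the rank function are partitioned by the orthants `a - ℕ^{Int(a)}`, `a ∈ P`. -/
theorem existsUnique_orthant (h : IsPolymatroid P f) {c : Fin n → ℤ}
    (hc : ∀ I : Finset (Fin n), ∑ i ∈ I, c i ≤ f I) :
    ∃! a, a ∈ P ∧ ∀ i, c i ≤ a i ∧ (c i < a i → i ∈ intActive P a) := by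
  obtain ⟨a₀, ha₀, hca₀⟩ := h.exists_basis_ge hc
  -- The weight `-i` rewards mass at small indices: moving a unit from `i` to some `j < i` would
  -- increase it.
  obtain ⟨a, ⟨ha, hca⟩, hmax⟩ := Set.exists_max_image {a | a ∈ P ∧ c ≤ a}
    (fun a => ∑ i, a i * (-(i : ℤ))) (h.finite.subset fun a ha => ha.1) ⟨a₀, ha₀, hca₀⟩
  have hact : ∀ i, c i < a i → i ∈ intActive P a := by
    refine fun i hi => mem_intActive.2 fun j hji hmem => ?_
    have h1 := hmax _ ⟨hmem, fun k => ?_⟩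
    · simp only [Pi.add_apply, Pi.sub_apply, add_mul, sub_mul, Finset.sum_add_distrib,
        Finset.sum_sub_distrib, Pi.single_apply, ite_mul, zero_mul, one_mul, Finset.sum_ite_eq',
        Finset.mem_univ, if_true] at h1
      have : ((j : ℕ) : ℤ) < (i : ℕ) := by exact_mod_cast hji
      omega
    · have : c k ≤ a k := hca k
      simp only [Pi.add_apply, Pi.sub_apply, Pi.single_apply]
      split_ifs with h1 h2 <;> (try subst h1) <;> omega
  refine ⟨a, ⟨ha, fun i => ⟨hca i, hact i⟩⟩, ?_⟩
  rintro b ⟨hb, hbc⟩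
  -- At the first index `j` where the bases differ, exchange yields `i > j` with `c i ≤ b i < a i`,
  -- contradicting activity of `i`.
  have key : ∀ {a b : Fin n → ℤ}, a ∈ P → b ∈ P → c ≤ b →
      (∀ i, c i < a i → i ∈ intActive P a) →
      ∀ j, (∀ k < j, a k = b k) → ¬ a j < b j := by
    intro a b ha hb hcb hact j hj hlt
    obtain ⟨i, hi, hmem⟩ := h.exchange ha hb hlt
    refine mem_intActive.1 (hact i ((hcb i).trans_lt hi)) j ?_ hmem
    rcases lt_trichotomy i j with h1 | h1 | h1
    · exact absurd (hj i h1) hi.ne'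
    · subst h1; omega
    · exact h1
  funext j
  induction j using WellFoundedLT.induction with
  | ind j ih =>
    have h1 := key hb ha hca (fun i => (hbc i).2) j ih
    have h2 := key ha hb (fun i => (hbc i).1) hact j fun k hk => (ih k hk).symm
    omega

end IsPolymatroid

/-! ### Counting identities over the integers -/

theorem Int.two_mul_choose_two (z : ℤ) : 2 * Ring.choose z 2 = z * (z - 1) := by
  have h := Ring.descPochhammer_eq_factorial_smul_choose z 2
  simp [descPochhammer_succ_right, Polynomial.smeval_mul, Polynomial.smeval_sub,
    Polynomial.smeval_X, Nat.factorial] at h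
  linarith

/-- Sums of consecutive odd numbers are squares; this weight makes a one-coordinate slice produce `y
i ^ 2`. -/
theorem Int.sum_Ioc_odd {m z : ℤ} (h : m ≤ z) :
    ∑ u ∈ Finset.Ioc m z, (2 * (u - m) - 1) = (z - m) ^ 2 := by
  induction z, h using Int.leInduction with
  | base => simp
  | succ z hz ih =>
    rw [← Finset.insert_Ioc_right_eq_Ioc_add_one hz, Finset.sum_insert (by simp), ih]
    ring

theorem Int.sum_Ioc_ite_le {m z F : ℤ} (h : m ≤ z) (hF : m ≤ F) :
    ∑ u ∈ Finset.Ioc m F, (if u ≤ z then (1 : ℤ) else 0) = min F z - m := by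
  rw [← Finset.sum_filter]
  have : (Finset.Ioc m F).filter (· ≤ z) = Finset.Ioc m (min F z) := by
    ext u; simp; omega
  rw [this]
  simp
  omega

/-- The number of lattice points of a rectangle with its upper right corner cut off. -/
theorem Int.card_truncated_box {m F G H : ℤ} (hFG : H ≤ F + G) (hF : m ≤ H - F) (hG : m ≤ H - G) :
    ∑ u ∈ Finset.Ioc m F, ∑ v ∈ Finset.Ioc m G, (if u + v ≤ H then (1 : ℤ) else 0) =
      (F - m) * (G - m) - Ring.choose (F + G - H + 1) 2 := by
  -- Up to `u = H - G` the columns have full height; beyond it each loses one more point, which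
  -- builds the triangle.
  have hmin : ∀ z, H - G ≤ z → 2 * ∑ u ∈ Finset.Ioc m z, (min G (H - u) - m) =
      2 * ((z - m) * (G - m)) - (z + G - H + 1) * (z + G - H) := by
    intro z hz
    induction z, hz using Int.leInduction with
    | base =>
      rw [Finset.sum_congr rfl fun u hu => by
        rw [min_eq_left (by rw [Finset.mem_Ioc] at hu; omega)]]
      simp only [Finset.sum_const, Int.card_Ioc, nsmul_eq_mul, Int.toNat_of_nonneg (sub_nonneg.2 hG)]
      ring
    | succ z hz ih =>
      rw [← Finset.insert_Ioc_right_eq_Ioc_add_one (by omega), Finset.sum_insert (by simp), mul_add,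
        ih, min_eq_right (by omega)]
      ring
  have hcount : ∑ u ∈ Finset.Ioc m F, ∑ v ∈ Finset.Ioc m G, (if u + v ≤ H then (1 : ℤ) else 0) =
      ∑ u ∈ Finset.Ioc m F, (min G (H - u) - m) := by
    refine Finset.sum_congr rfl fun u hu => ?_
    rw [Finset.mem_Ioc] at hu
    have h1 := Int.sum_Ioc_ite_le (m := m) (z := H - u) (F := G) (by omega) (by omega)
    simpa only [le_sub_iff_add_le'] using h1
  have h1 := hmin F (by omega)
  have h2 := Int.two_mul_choose_two (F + G - H + 1)
  rw [hcount]
  linarith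

/-- Twice the sum over pairs of a symmetric function is the sum over the off-diagonal. -/
theorem Finset.two_mul_sum_sum_Ioi {n : ℕ} (F : Fin n → Fin n → ℤ) (hF : ∀ i j, F i j = F j i) :
    2 * ∑ i, ∑ j ∈ Finset.Ioi i, F i j = ∑ i, ∑ j, F i j - ∑ i, F i i := by
  have h : ∀ i, ∑ j, F i j = F i i + ∑ j ∈ Finset.Ioi i, F i j + ∑ j ∈ Finset.Iio i, F i j := by
    intro i
    have : (Finset.univ : Finset (Fin n)) = insert i (Finset.Ioi i ∪ Finset.Iio i) := by
      ext j; simp; omega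
    rw [this, Finset.sum_insert (by simp), Finset.sum_union, add_assoc]
    rw [Finset.disjoint_left]
    intro j
    simp only [Finset.mem_Ioi, Finset.mem_Iio]
    omega
  have h2 : ∑ i, ∑ j ∈ Finset.Iio i, F i j = ∑ i, ∑ j ∈ Finset.Ioi i, F i j := by
    rw [Finset.sum_comm' (t' := Finset.univ) (s' := fun j => Finset.Ioi j) (by simp)]
    simp only [hF]
  simp only [h, Finset.sum_add_distrib, h2]
  ring

/-- An indicator of two-element sets as a combination of weighted counts of the sets of size at
most two that contain a given set `B`. -/
theorem Finset.indicator_card_two {n : ℕ} (B : Finset (Fin n)) (y : Fin n → ℤ) :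
    2 * ∑ i, ∑ j ∈ Finset.Ioi i, (if B ⊆ {i, j} then
        (if i ∈ B then 1 else y i) * (if j ∈ B then 1 else y j) else 0) +
      ∑ i, (if B ⊆ {i} then (if i ∈ B then 2 * y i - 1 else y i ^ 2) else 0) -
      (2 * ∑ i, y i - 1) * ∑ i, (if B ⊆ {i} then (if i ∈ B then 1 else y i) else 0) +
      ((∑ i, y i) ^ 2 - ∑ i, y i) * (if B = ∅ then 1 else 0) =
    2 * if B.card = 2 then 1 else 0 := by
  rw [Finset.two_mul_sum_sum_Ioi _ (by intro i j; rw [Finset.pair_comm, mul_comm])]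
  -- For `B = ∅` this is `(∑ y i)² = 2 ∑_{i<j} y i y j + ∑ y i ^ 2`; for a singleton the linear
  -- terms cancel; for a pair only the first sum survives.
  rcases Nat.lt_or_ge 2 B.card with h3 | h2
  · have h1 : ∀ i, ¬ B ⊆ {i} := fun i hi => by
      have := Finset.card_le_card hi
      simp at this; omega
    have h2 : ∀ i j, ¬ B ⊆ {i, j} := fun i j hi => by
      have := (Finset.card_le_card hi).trans Finset.card_le_two
      omega
    have h0 : B ≠ ∅ := by rintro rfl; simp at h3
    simp [h1, h2, h0, h3.ne']
  · interval_cases hc : B.card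
    · rw [Finset.card_eq_zero] at hc
      subst hc
      simp [← Finset.mul_sum, ← Finset.sum_mul, pow_two]
      ring
    · obtain ⟨k, rfl⟩ := Finset.card_eq_one.1 hc
      have hF : ∀ i j : Fin n, (if ({k} : Finset (Fin n)) ⊆ {i, j} then
          (if i ∈ ({k} : Finset (Fin n)) then 1 else y i) *
          (if j ∈ ({k} : Finset (Fin n)) then 1 else y j) else 0) =
          (if i = k then y j else 0) + (if j = k then y i else 0) +
          (if i = k then if j = k then 1 - 2 * y k else 0 else 0) := by
        intro i j
        by_cases hi : i = k <;> by_cases hj : j = k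
        · subst hi; subst hj; simp; ring
        · subst hi; simp [hj]
        · subst hj; simp [hi]
        · simp [hi, hj, Ne.symm hi, Ne.symm hj]
      have hG : ∀ i (z z' : ℤ) , (if ({k} : Finset (Fin n)) ⊆ {i} then
          (if i ∈ ({k} : Finset (Fin n)) then z else z') else 0) = if i = k then z else 0 := by
        intro i z z'
        by_cases hi : i = k
        · simp [hi]
        · simp [hi, Ne.symm hi]
      simp only [hF, hG]
      simp [Finset.sum_add_distrib]
      ring
    · obtain ⟨k, l, hkl, rfl⟩ := Finset.card_eq_two.1 hc
      have h1 : ∀ i, ¬ ({k, l} : Finset (Fin n)) ⊆ {i} := fun i hi => by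
        have := Finset.card_le_card hi
        simp [hc] at this
      have hF : ∀ i j : Fin n, (if ({k, l} : Finset (Fin n)) ⊆ {i, j} then
          (if i ∈ ({k, l} : Finset (Fin n)) then 1 else y i) *
          (if j ∈ ({k, l} : Finset (Fin n)) then 1 else y j) else 0) =
          (if i = k then if j = l then 1 else 0 else 0) +
          (if i = l then if j = k then 1 else 0 else 0) := by
        intro i j
        simp only [Finset.insert_subset_iff, Finset.singleton_subset_iff, Finset.mem_insert,
          Finset.mem_singleton]
        split_ifs <;> grind
      have h0 : ({k, l} : Finset (Fin n)) ≠ ∅ := by simp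
      simp only [hF, h1, h0, if_false]
      simp [Finset.sum_add_distrib, hkl, hkl.symm]

/-! ### Slices of the orthant decomposition -/

namespace IsPolymatroid

variable {n : ℕ} {P : Set (Fin n → ℤ)} {f : Finset (Fin n) → ℤ}

/-- A vector that is very negative outside a set `S` of at most two indices lies below the rank
function as soon as it does so on the subsets of `S`. -/
theorem sum_le_rank_of_subset {K : ℤ} (hK : ∀ I, |f I| ≤ K) {S : Finset (Fin n)}
    (hS : S.card ≤ 2) {c : Fin n → ℤ} (hcS : ∀ i ∈ S, c i ≤ K)
    (hc : ∀ i ∉ S, c i = -(3 * K + 1)) (hf : ∀ I ⊆ S, ∑ i ∈ I, c i ≤ f I)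
    (I : Finset (Fin n)) : ∑ i ∈ I, c i ≤ f I := by
  by_cases hI : I ⊆ S
  · exact hf I hI
  have hK0 : 0 ≤ K := (abs_nonneg _).trans (hK ∅)
  obtain ⟨k, hk, hkS⟩ := Finset.not_subset.1 hI
  have h1 : ∑ i ∈ I ∩ S, c i ≤ (I ∩ S).card • K :=
    Finset.sum_le_card_nsmul _ _ _ fun i hi => hcS i (Finset.mem_inter.1 hi).2
  have h2 : ∑ i ∈ I \ S, c i ≤ (I \ S).card • -(3 * K + 1) :=
    Finset.sum_le_card_nsmul _ _ _ fun i hi => (hc i (Finset.mem_sdiff.1 hi).2).le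
  -- At most two entries `≤ K` and at least one `-(3K+1)` sum to at most `-K - 1 < f I`.
  have h3 : (((I ∩ S).card : ℕ) : ℤ) ≤ 2 := by
    exact_mod_cast (Finset.card_le_card Finset.inter_subset_right).trans hS
  have h4 : (1 : ℤ) ≤ ((I \ S).card : ℕ) := by
    exact_mod_cast Finset.card_pos.2 ⟨k, Finset.mem_sdiff.2 ⟨hk, hkS⟩⟩
  have h5 := Finset.sum_inter_add_sum_sdiff I S c
  have h6 := abs_le.1 (hK I)
  simp only [nsmul_eq_mul] at h1 h2
  nlinarith

/-- Ensures that a slice coordinate set to `-(3K+1)` lies strictly below every basis, which forces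
that index to be active. -/
theorem neg_lt_of_mem (h : IsPolymatroid P f) {K : ℤ} (hK : ∀ I, |f I| ≤ K)
    {a : Fin n → ℤ} (ha : a ∈ P) (i : Fin n) : -(3 * K + 1) < a i := by
  rw [h.mem_iff] at ha
  have h1 := ha.1 {i}ᶜ
  have h2 := Finset.sum_add_sum_compl {i} a
  have h3 := abs_le.1 (hK Finset.univ)
  have h4 := abs_le.1 (hK {i}ᶜ)
  simp only [Finset.sum_singleton] at h2
  linarith

theorem le_rank_singleton (h : IsPolymatroid P f) {a : Fin n → ℤ} (ha : a ∈ P) (i : Fin n) :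
    a i ≤ f {i} := by
  simpa using (h.mem_iff.1 ha).1 {i}

open Classical in
/-- Summing over the orthant decomposition. -/
theorem sum_orthant (h : IsPolymatroid P f) {c : Fin n → ℤ}
    (hc : ∀ I : Finset (Fin n), ∑ i ∈ I, c i ≤ f I) (z : ℤ) :
    ∑ a ∈ h.finite.toFinset,
      (if ∀ i, c i ≤ a i ∧ (c i < a i → i ∉ (intActive P a)ᶜ) then z else 0) = z := by
  obtain ⟨a, ⟨ha, hca⟩, huniq⟩ := h.existsUnique_orthant hc
  rw [Finset.sum_eq_single a]
  · simp only [Finset.mem_compl, not_not]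
    rw [if_pos hca]
  · intro b hb hba
    rw [if_neg]
    simp only [Finset.mem_compl, not_not]
    exact fun hbc => hba (huniq b ⟨(h.finite.mem_toFinset).1 hb, hbc⟩)
  · intro hn
    exact absurd ((h.finite.mem_toFinset).2 ha) hn

/-- The number of bases without internally inactive index is one. -/
theorem sum_inactive_eq_empty (h : IsPolymatroid P f) :
    ∑ a ∈ h.finite.toFinset, (if (intActive P a)ᶜ = ∅ then (1 : ℤ) else 0) = 1 := by
  classical
  obtain ⟨K, hK⟩ : ∃ K, ∀ I, |f I| ≤ K :=
    ⟨∑ I, |f I|, fun I => Finset.single_le_sum (fun I _ => abs_nonneg (f I)) (Finset.mem_univ I)⟩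
  refine Eq.trans (Finset.sum_congr rfl fun a ha => ?_) (h.sum_orthant
    (c := fun _ => -(3 * K + 1)) (sum_le_rank_of_subset hK (S := ∅)
    (by simp) (by simp) (by simp) (by simp [Finset.subset_empty, h.rank_empty])) 1)
  rw [h.finite.mem_toFinset] at ha
  have h1 := h.neg_lt_of_mem hK ha
  simp only [h1, (h1 _).le, true_and, true_imp_iff, Finset.eq_empty_iff_forall_notMem]

/-- One coordinate of an orthant, with `p` meaning inactive: the coordinate is then pinned to `z`,
and otherwise runs down to the box bottom. -/
theorem sum_Ioc_orthant {m F z : ℤ} (hm : m < z) (hF : z ≤ F) (p : Prop) [Decidable p]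
    (φ : ℤ → ℤ) :
    ∑ u ∈ Finset.Ioc m F, (if u ≤ z ∧ (u < z → ¬ p) then φ u else 0) =
      if p then φ z else ∑ u ∈ Finset.Ioc m z, φ u := by
  rw [← Finset.sum_filter]
  split_ifs with hp
  · have : (Finset.Ioc m F).filter (fun u => u ≤ z ∧ (u < z → ¬ p)) = {z} := by
      ext u; simp [hp]; omega
    rw [this, Finset.sum_singleton]
  · have : (Finset.Ioc m F).filter (fun u => u ≤ z ∧ (u < z → ¬ p)) = Finset.Ioc m z := by
      ext u; simp [hp]; omega
    rw [this]

/-- Double counting, weighted by `φ`, of the vectors below `f` whose only free coordinate is `i`. -/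
theorem sum_slice_one (h : IsPolymatroid P f) {K : ℤ} (hK : ∀ I, |f I| ≤ K) (i : Fin n)
    (φ : ℤ → ℤ) :
    ∑ a ∈ h.finite.toFinset, (if (intActive P a)ᶜ ⊆ {i} then
      (if i ∈ (intActive P a)ᶜ then φ (a i) else ∑ u ∈ Finset.Ioc (-(3 * K + 1)) (a i), φ u)
        else 0) = ∑ u ∈ Finset.Ioc (-(3 * K + 1)) (f {i}), φ u := by
  classical
  have hu := fun u (hu : u ∈ Finset.Ioc (-(3 * K + 1)) (f {i})) => (h.sum_orthant (c := fun k => if k = i then u else -(3 * K + 1))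
      (sum_le_rank_of_subset hK (S := {i}) (by simp) (by
        have := abs_le.1 (hK {i})
        rw [Finset.mem_Ioc] at hu
        simp; omega) (by simp +contextual) (by
        rw [Finset.mem_Ioc] at hu
        intro I hI
        rcases Finset.subset_singleton_iff.1 hI with rfl | rfl
        · simp [h.rank_empty]
        · simpa using hu.2)) (φ u)).symm
  rw [Finset.sum_congr rfl hu, Finset.sum_comm]
  refine Finset.sum_congr rfl fun a ha => ?_
  rw [h.finite.mem_toFinset] at ha
  have h1 := h.neg_lt_of_mem hK ha
  have hiff : ∀ u, (∀ k, (if k = i then u else -(3 * K + 1)) ≤ a k ∧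
      ((if k = i then u else -(3 * K + 1)) < a k → k ∉ (intActive P a)ᶜ)) ↔
      (intActive P a)ᶜ ⊆ {i} ∧ (u ≤ a i ∧ (u < a i → ¬ i ∈ (intActive P a)ᶜ)) := by
    intro u
    constructor
    · intro hk
      refine ⟨fun k hkB => ?_, by simpa using hk i⟩
      by_contra hki
      rw [Finset.mem_singleton] at hki
      have := (hk k).2
      rw [if_neg hki] at this
      exact this (h1 k) hkB
    · rintro ⟨hB, hi⟩ k
      by_cases hki : k = i
      · subst hki; simpa using hi
      · rw [if_neg hki]
        exact ⟨(h1 k).le, fun _ hkB => hki (Finset.mem_singleton.1 (hB hkB))⟩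
  simp only [hiff]
  by_cases hB : (intActive P a)ᶜ ⊆ {i}
  · simp only [hB, if_true, true_and]
    exact (sum_Ioc_orthant (h1 i) (h.le_rank_singleton ha i) _ φ).symm
  · simp [hB]

/-- The same double counting with two free coordinates, where `f {i, j}` cuts a corner off the box.
-/
theorem sum_slice_two (h : IsPolymatroid P f) {K : ℤ} (hK : ∀ I, |f I| ≤ K) {i j : Fin n}
    (hij : i ≠ j) :
    ∑ a ∈ h.finite.toFinset, (if (intActive P a)ᶜ ⊆ {i, j} then
      (if i ∈ (intActive P a)ᶜ then 1 else a i + (3 * K + 1)) *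
      (if j ∈ (intActive P a)ᶜ then 1 else a j + (3 * K + 1)) else 0) =
    ∑ u ∈ Finset.Ioc (-(3 * K + 1)) (f {i}), ∑ v ∈ Finset.Ioc (-(3 * K + 1)) (f {j}),
      (if u + v ≤ f {i, j} then (1 : ℤ) else 0) := by
  classical
  have hiff : ∀ a ∈ P, ∀ u v,
      (∀ k, (if k = i then u else if k = j then v else -(3 * K + 1)) ≤ a k ∧
      ((if k = i then u else if k = j then v else -(3 * K + 1)) < a k →
        k ∉ (intActive P a)ᶜ)) ↔
      (intActive P a)ᶜ ⊆ {i, j} ∧ (u ≤ a i ∧ (u < a i → ¬ i ∈ (intActive P a)ᶜ)) ∧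
        (v ≤ a j ∧ (v < a j → ¬ j ∈ (intActive P a)ᶜ)) := by
    intro a ha u v
    have h1 := h.neg_lt_of_mem hK ha
    constructor
    · intro hk
      refine ⟨fun k hkB => ?_, by simpa using hk i, by simpa [hij.symm] using hk j⟩
      by_contra hki
      rw [Finset.mem_insert, Finset.mem_singleton, not_or] at hki
      have := (hk k).2
      rw [if_neg hki.1, if_neg hki.2] at this
      exact this (h1 k) hkB
    · rintro ⟨hB, hi, hj⟩ k
      by_cases hki : k = i
      · subst hki; simpa using hi
      by_cases hkj : k = j
      · subst hkj; simpa [hki] using hj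
      · rw [if_neg hki, if_neg hkj]
        refine ⟨(h1 k).le, fun _ hkB => ?_⟩
        have := hB hkB
        simp [hki, hkj] at this
  have huv : ∀ u ∈ Finset.Ioc (-(3 * K + 1)) (f {i}), ∀ v ∈ Finset.Ioc (-(3 * K + 1)) (f {j}),
      (if u + v ≤ f {i, j} then (1 : ℤ) else 0) = ∑ a ∈ h.finite.toFinset,
        if (∀ k, (if k = i then u else if k = j then v else -(3 * K + 1)) ≤ a k ∧
          ((if k = i then u else if k = j then v else -(3 * K + 1)) < a k →
            k ∉ (intActive P a)ᶜ)) then 1 else 0 := by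
    intro u hu v hv
    rw [Finset.mem_Ioc] at hu hv
    split_ifs with hle
    · refine (h.sum_orthant (c := fun k => if k = i then u else if k = j then v else -(3 * K + 1))
        (sum_le_rank_of_subset hK (S := {i, j}) Finset.card_le_two ?_ ?_ ?_) 1).symm
      · have h1 := abs_le.1 (hK {i})
        have h2 := abs_le.1 (hK {j})
        intro k hk
        split_ifs
        · omega
        · omega
        · simp_all
      · intro k hk
        simp only [Finset.mem_insert, Finset.mem_singleton, not_or] at hk
        simp [hk]
      · intro I hI
        rw [← Finset.mem_powerset] at hI
        have hI' : I = ∅ ∨ I = {i} ∨ I = {j} ∨ I = {i, j} := by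
          rw [Finset.mem_powerset, Finset.subset_insert_iff, Finset.subset_singleton_iff] at hI
          by_cases hiI : i ∈ I
          · rw [← Finset.insert_erase hiI]
            rcases hI with hI | hI <;> simp [hI]
          · rw [Finset.erase_eq_of_notMem hiI] at hI
            tauto
        rcases hI' with rfl | rfl | rfl | rfl
        · simp [h.rank_empty]
        · simpa using hu.2
        · simpa [hij.symm] using hv.2
        · simpa [Finset.sum_pair hij, hij.symm] using hle
    · symm
      refine Finset.sum_eq_zero fun a ha => if_neg fun hca => ?_
      rw [h.finite.mem_toFinset] at ha
      rw [hiff a ha] at hca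
      have h1 := (h.mem_iff.1 ha).1 {i, j}
      rw [Finset.sum_pair hij] at h1
      omega
  rw [Finset.sum_congr rfl fun u hu => Finset.sum_congr rfl fun v hv => huv u hu v hv]
  simp only [Finset.sum_comm (t := h.finite.toFinset)]
  refine Finset.sum_congr rfl fun a ha => ?_
  rw [h.finite.mem_toFinset] at ha
  have h1 := h.neg_lt_of_mem hK ha
  simp only [hiff a ha]
  by_cases hB : (intActive P a)ᶜ ⊆ {i, j}
  · simp only [hB, if_true, true_and]
    have hi := sum_Ioc_orthant (h1 i) (h.le_rank_singleton ha i) (i ∈ (intActive P a)ᶜ) fun _ => 1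
    have hj := sum_Ioc_orthant (h1 j) (h.le_rank_singleton ha j) (j ∈ (intActive P a)ᶜ) fun _ => 1
    have hcard : ∀ z, -(3 * K + 1) < z →
        ∑ u ∈ Finset.Ioc (-(3 * K + 1)) z, (1 : ℤ) = z + (3 * K + 1) := by
      intro z hz
      simp
      omega
    rw [hcard _ (h1 _)] at hi hj
    rw [← hi, ← hj, Finset.sum_mul_sum]
    refine Finset.sum_congr rfl fun u _ => Finset.sum_congr rfl fun v _ => ?_
    by_cases hu : u ≤ a i ∧ (u < a i → ¬ i ∈ (intActive P a)ᶜ)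
    · rw [if_pos hu, one_mul]
      exact if_congr (and_iff_right hu).symm rfl rfl
    · rw [if_neg hu, zero_mul, if_neg fun hh => hu hh.1]
  · simp [hB]

/-- The number of bases with exactly two internally inactive indices. -/
theorem sum_card_inactive_eq_two (h : IsPolymatroid P f) :
    ∑ a ∈ h.finite.toFinset, (if (intActive P a)ᶜ.card = 2 then (1 : ℤ) else 0) =
      Ring.choose ((∑ i, f {i}) - f Finset.univ + 1) 2 -
        ∑ i, ∑ j ∈ Finset.Ioi i, Ring.choose (f {i} + f {j} - f {i, j} + 1) 2 := by
  obtain ⟨K, hK⟩ : ∃ K, ∀ I, |f I| ≤ K :=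
    ⟨∑ I, |f I|, fun I => Finset.single_le_sum (fun I _ => abs_nonneg (f I)) (Finset.mem_univ I)⟩
  have hfK := fun I => abs_le.1 (hK I)
  -- `Y` is the common value of `∑ y i` on `P`, so the coefficients of the indicator identity do not
  -- depend on `a`.
  set Y : ℤ := f Finset.univ + n * (3 * K + 1) with hY
  have hsumY : ∀ a ∈ P, ∑ i, (a i + (3 * K + 1)) = Y := by
    intro a ha
    simp [Finset.sum_add_distrib, (h.mem_iff.1 ha).2, hY]
  have hE0 := h.sum_inactive_eq_empty
  have hcard : ∀ z, -(3 * K + 1) ≤ z →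
      ∑ u ∈ Finset.Ioc (-(3 * K + 1)) z, (1 : ℤ) = z + (3 * K + 1) := by
    intro z hz
    simp
    omega
  have hE1 : ∀ i, ∑ a ∈ h.finite.toFinset, (if (intActive P a)ᶜ ⊆ {i} then
      (if i ∈ (intActive P a)ᶜ then 1 else a i + (3 * K + 1)) else 0) = f {i} + (3 * K + 1) := by
    intro i
    rw [← hcard _ (by linarith [hfK {i}]), ← h.sum_slice_one hK i]
    refine Finset.sum_congr rfl fun a ha => ?_
    rw [h.finite.mem_toFinset] at ha
    rw [hcard _ (h.neg_lt_of_mem hK ha i).le]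
  have hE1' : ∀ i, ∑ a ∈ h.finite.toFinset, (if (intActive P a)ᶜ ⊆ {i} then
      (if i ∈ (intActive P a)ᶜ then 2 * (a i + (3 * K + 1)) - 1 else (a i + (3 * K + 1)) ^ 2)
        else 0) = (f {i} + (3 * K + 1)) ^ 2 := by
    intro i
    have := Int.sum_Ioc_odd (m := -(3 * K + 1)) (z := f {i}) (by linarith [hfK {i}])
    simp only [sub_neg_eq_add] at this
    rw [← this, ← h.sum_slice_one hK i]
    refine Finset.sum_congr rfl fun a ha => ?_
    rw [h.finite.mem_toFinset] at ha
    have := Int.sum_Ioc_odd (h.neg_lt_of_mem hK ha i).le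
    simp only [sub_neg_eq_add] at this
    rw [this]
  have hE2 : ∀ i, ∀ j ∈ Finset.Ioi i, ∑ a ∈ h.finite.toFinset,
      (if (intActive P a)ᶜ ⊆ {i, j} then
      (if i ∈ (intActive P a)ᶜ then 1 else a i + (3 * K + 1)) *
      (if j ∈ (intActive P a)ᶜ then 1 else a j + (3 * K + 1)) else 0) =
      (f {i} + (3 * K + 1)) * (f {j} + (3 * K + 1)) -
        Ring.choose (f {i} + f {j} - f {i, j} + 1) 2 := by
    intro i j hj
    have hij : i ≠ j := (Finset.mem_Ioi.1 hj).ne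
    have hsub := h.submodular {i} {j}
    rw [Finset.singleton_inter_of_notMem (by simpa using hij), h.rank_empty] at hsub
    rw [h.sum_slice_two hK hij, Int.card_truncated_box]
    · simp only [sub_neg_eq_add]
    · simpa using hsub
    · linarith [hfK {i, j}, hfK {i}]
    · linarith [hfK {i, j}, hfK {j}]
  have hmain : ∑ a ∈ h.finite.toFinset, 2 * (if (intActive P a)ᶜ.card = 2 then (1 : ℤ) else 0) =
      ∑ a ∈ h.finite.toFinset, (2 * ∑ i, ∑ j ∈ Finset.Ioi i, (if (intActive P a)ᶜ ⊆ {i, j} then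
        (if i ∈ (intActive P a)ᶜ then 1 else a i + (3 * K + 1)) *
        (if j ∈ (intActive P a)ᶜ then 1 else a j + (3 * K + 1)) else 0) +
      ∑ i, (if (intActive P a)ᶜ ⊆ {i} then (if i ∈ (intActive P a)ᶜ then
        2 * (a i + (3 * K + 1)) - 1 else (a i + (3 * K + 1)) ^ 2) else 0) -
      (2 * Y - 1) * ∑ i, (if (intActive P a)ᶜ ⊆ {i} then
        (if i ∈ (intActive P a)ᶜ then 1 else a i + (3 * K + 1)) else 0) +
      (Y ^ 2 - Y) * (if (intActive P a)ᶜ = ∅ then 1 else 0)) := by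
    refine Finset.sum_congr rfl fun a ha => ?_
    rw [← Finset.indicator_card_two (intActive P a)ᶜ fun i => a i + (3 * K + 1),
      hsumY a (h.finite.mem_toFinset.1 ha)]
  have hT2 := Finset.sum_congr (rfl : (Finset.univ : Finset (Fin n)) = _) fun i _ =>
    Finset.sum_congr rfl (hE2 i)
  simp only [← Finset.sum_comm (s := h.finite.toFinset)] at hT2
  have hT1 := Finset.sum_congr (rfl : (Finset.univ : Finset (Fin n)) = _) fun i _ => hE1 i
  have hT1' := Finset.sum_congr (rfl : (Finset.univ : Finset (Fin n)) = _) fun i _ => hE1' i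
  rw [Finset.sum_comm] at hT1 hT1'
  simp only [Finset.sum_add_distrib, Finset.sum_sub_distrib, ← Finset.mul_sum, hE0] at hmain
  rw [hT1, hT1', hT2] at hmain
  simp only [Finset.sum_sub_distrib] at hmain
  -- With `X = ∑ (f {i} + 3K + 1)`, the terms without binomials add up to `(X - Y)(X - Y + 1)`, and
  -- the cutoff cancels in `X - Y`.
  have hsq := Finset.two_mul_sum_sum_Ioi
    (fun i j : Fin n => (f {i} + (3 * K + 1)) * (f {j} + (3 * K + 1))) fun i j => mul_comm _ _
  simp only [← Finset.mul_sum, ← Finset.sum_mul] at hsq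
  have hX : ∑ i : Fin n, (f {i} + (3 * K + 1)) = (∑ i, f {i}) + n * (3 * K + 1) := by
    simp [Finset.sum_add_distrib]
  have hch := Int.two_mul_choose_two ((∑ i, f {i}) - f Finset.univ + 1)
  have hsq' : ∀ i : Fin n, (f {i} + (3 * K + 1)) * (f {i} + (3 * K + 1)) =
      (f {i} + (3 * K + 1)) ^ 2 := fun i => (pow_two _).symm
  simp only [hsq'] at hsq
  rw [hX] at hmain hsq
  generalize (n : ℤ) * (3 * K + 1) = t at *
  rw [hY] at hmain
  simp only [← Finset.mul_sum] at hmain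
  linarith

end IsPolymatroid

/-! ### Duality, specializations, and the coefficients -/

namespace IsPolymatroid

variable {n : ℕ} {P : Set (Fin n → ℤ)} {f : Finset (Fin n) → ℤ}

/-- The dual polymatroid `-P`. -/
theorem dual (h : IsPolymatroid P f) :
    IsPolymatroid {b | -b ∈ P} (fun I => f Iᶜ - f Finset.univ) where
  rank_empty := by simp
  submodular I J := by
    have := h.submodular Iᶜ Jᶜ
    rw [Finset.compl_union, Finset.compl_inter]
    linarith
  eq_bases := by
    ext b
    have h0 := h.rank_empty
    simp only [Set.mem_ofPred_eq, h.mem_iff, Pi.neg_apply, Finset.sum_neg_distrib,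
      Finset.compl_univ, h0]
    constructor
    · rintro ⟨h1, h2⟩
      refine ⟨fun I => ?_, by linarith⟩
      have h3 := h1 Iᶜ
      have h4 := Finset.sum_add_sum_compl I b
      linarith
    · rintro ⟨h1, h2⟩
      refine ⟨fun I => ?_, by linarith⟩
      have h3 := h1 Iᶜ
      have h4 := Finset.sum_add_sum_compl I b
      rw [compl_compl] at h3
      linarith

theorem intActive_dual (a : Fin n → ℤ) : intActive {b | -b ∈ P} (-a) = extActive P a := by
  ext i
  simp only [intActive, extActive, Finset.mem_filter, Finset.mem_univ, true_and,
    InternallyActive, ExternallyActive, Set.mem_ofPred_eq]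
  refine forall₂_congr fun j _ => ?_
  rw [show -(-a - Pi.single i 1 + Pi.single j 1 : Fin n → ℤ) = a + Pi.single i 1 - Pi.single j 1
    by abel]

theorem polymatroidTutte_eq_sum (h : IsPolymatroid P f) :
    polymatroidTutte P = ∑ a ∈ h.finite.toFinset,
      MvPolynomial.X 0 ^ (intActive P a \ extActive P a).card *
      MvPolynomial.X 1 ^ (extActive P a \ intActive P a).card *
      (MvPolynomial.X 0 + MvPolynomial.X 1 - 1) ^ (intActive P a ∩ extActive P a).card :=
  finsum_mem_eq_finite_toFinset_sum _ h.finite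

/-- At `y = 1` both `x` and `x + y - 1` become `x`, so the exponents over `Int \ Ext` and `Int ∩
Ext` merge. -/
theorem specializeX_polymatroidTutte (h : IsPolymatroid P f) :
    specializeX (polymatroidTutte P) =
      ∑ a ∈ h.finite.toFinset, Polynomial.X ^ (intActive P a).card := by
  rw [h.polymatroidTutte_eq_sum, specializeX, map_sum]
  refine Finset.sum_congr rfl fun a _ => ?_
  simp only [map_mul, map_pow, map_sub, map_add, MvPolynomial.aeval_X, map_one,
    Matrix.cons_val_zero, Matrix.cons_val_one, one_pow, mul_one, add_sub_cancel_right]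
  rw [← pow_add, Finset.card_sdiff_add_card_inter]

theorem specializeY_polymatroidTutte (h : IsPolymatroid P f) :
    specializeY (polymatroidTutte P) =
      ∑ a ∈ h.finite.toFinset, Polynomial.X ^ (extActive P a).card := by
  rw [h.polymatroidTutte_eq_sum, specializeY, map_sum]
  refine Finset.sum_congr rfl fun a _ => ?_
  simp only [map_mul, map_pow, map_sub, map_add, MvPolynomial.aeval_X, map_one,
    Matrix.cons_val_zero, Matrix.cons_val_one, one_pow, one_mul, add_sub_cancel_left]
  rw [← pow_add, Finset.inter_comm, Finset.card_sdiff_add_card_inter]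

end IsPolymatroid

/-- For `n < 2` both sides vanish, as no complement has two elements. -/
theorem coeffAt_sum_X_pow_card {n : ℕ} {α : Type*} (s : Finset α) (A : α → Finset (Fin n)) :
    coeffAt (∑ a ∈ s, Polynomial.X ^ (A a).card) ((n : ℤ) - 2) =
      ∑ a ∈ s, (if (A a)ᶜ.card = 2 then (1 : ℤ) else 0) := by
  have hc : ∀ a, (A a).card + (A a)ᶜ.card = n := fun a => by
    simp
  unfold coeffAt
  split_ifs with hn
  · rw [Polynomial.finsetSum_coeff]
    refine Finset.sum_congr rfl fun a _ => ?_
    rw [Polynomial.coeff_X_pow]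
    have := hc a
    exact if_congr (by omega) rfl rfl
  · symm
    refine Finset.sum_eq_zero fun a _ => if_neg ?_
    have := hc a
    omega

theorem corollary5p5 {n : ℕ} (P : Set (Fin n → ℤ)) (f : Finset (Fin n) → ℤ)
    (hP : IsPolymatroid P f) :
    coeffAt (specializeX (polymatroidTutte P)) ((n : ℤ) - 2) =
        Ring.choose ((∑ i, f {i}) - f Finset.univ + 1) 2 -
          ∑ i, ∑ j ∈ Finset.Ioi i, Ring.choose (f {i} + f {j} - f {i, j} + 1) 2 ∧
      coeffAt (specializeY (polymatroidTutte P)) ((n : ℤ) - 2) =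
        Ring.choose ((∑ i, f {i}ᶜ) - ((n : ℤ) - 1) * f Finset.univ + 1) 2 -
          ∑ i, ∑ j ∈ Finset.Ioi i,
            Ring.choose (f {i}ᶜ + f {j}ᶜ - f {i, j}ᶜ - f Finset.univ + 1) 2 := by
  constructor
  · rw [hP.specializeX_polymatroidTutte, coeffAt_sum_X_pow_card, hP.sum_card_inactive_eq_two]
  · rw [hP.specializeY_polymatroidTutte, coeffAt_sum_X_pow_card]
    have hdual := hP.dual.sum_card_inactive_eq_two
    have hneg : ∑ a ∈ hP.finite.toFinset, (if (extActive P a)ᶜ.card = 2 then (1 : ℤ) else 0) =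
        ∑ b ∈ hP.dual.finite.toFinset,
          (if (intActive {b | -b ∈ P} b)ᶜ.card = 2 then (1 : ℤ) else 0) :=
      Finset.sum_nbij' (fun a => -a) (fun b => -b) (by simp) (by simp) (by simp) (by simp)
        fun a _ => by rw [IsPolymatroid.intActive_dual]
    rw [hneg, hdual]
    congr 1
    · congr 1
      simp [Finset.sum_sub_distrib, hP.rank_empty]
      ring
    · refine Finset.sum_congr rfl fun i _ => Finset.sum_congr rfl fun j _ => ?_
      congr 1
      ring
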